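/- Let $\mathbb{F}_q$ be the finite field with $q$ elements and let $p$ be its characteristic. Let $H$ be a multiplicative subgroup of $\mathbb{F}_q^*$ of index $m$, so that $|H| = (q-1)/m$. For a positive integer $k$ and $b \in \mathbb{F}_q$, let $M_H(k,b)$ be the number of $k$-element subsets $S \subseteq H$ with $\sum_{a\in S} a = b$, the sum being taken in $\mathbb{F}_q$. For real $x$ write $\binom{x}{k} = \frac{x(x-1)\cdots(x-k+1)}{k!}$. Suppose that $1 \le k \le (q-1)/m$. Then for every $b \in \mathbb{F}_q^*$, $$\left| M_H(k,b) - \frac{1}{q}\binom{(q-1)/m}{k} \right| \le \frac{2}{\sqrt{q}} \binom{\sqrt{q} + k + \frac{q}{mp}}{k},$$ and for $b = 0$, $$\left| M_H(k,0) - \frac{1}{q}\binom{(q-1)/m}{k} \right| \le \binom{\sqrt{q} + k + \frac{q}{mp}}{k}.$$ -/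

import Mathlib

/-- `subsetSumCount A k b` is the number of `k`-element subsets `S ⊆ A` of an additive commutative
monoid with `∑ a ∈ S, a = b`. -/
noncomputable def subsetSumCount {F : Type*} [AddCommMonoid F] (A : Set F) (k : ℕ) (b : F) : ℕ :=
  {S : Finset F | (S : Set F) ⊆ A ∧ S.card = k ∧ ∑ a ∈ S, a = b}.ncard

/-! Additive characters turn `q * M_H(k, b)` into a sum over `c` of `ψ (-b * c)` times the `k`-th
elementary symmetric polynomial `e_k(c)` of the values `ψ (c * h)`, `h ∈ H`; the term `c = 0` is the
main term. For `c ≠ 0`, Newton's identities build `e_k` from the power sums `∑ h, ψ (l * c * h)`. If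
`p ∤ l` this is a Gauss period, a combination of multiplicative characters of `c` with total weight
at most `√q`; if `p ∣ l` it is the constant `|H| ≤ q / m`. Total weights are submultiplicative, so
induction bounds that of `e_k` by the binomial coefficient `C` of the theorem
(`hasCharSum_subsetCharSum`). For `b ≠ 0`, summing against `ψ (-b * c)` turns each character into a
Gauss sum, of size at most `√q`; for `b = 0` the bound `|e_k(c)| ≤ C` suffices. -/

open Finset

/-! ### Rising binomial coefficients and the recursive inequality -/

/-- The rising binomial coefficients `n ↦ (y + 1) ⋯ (y + n) / n!`. -/
noncomputable def shiftedChoose (y : ℝ) (n : ℕ) : ℝ := Ring.choose (y + n) n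

theorem shiftedChoose_zero (y : ℝ) : shiftedChoose y 0 = 1 := by
  simp [shiftedChoose]

theorem shiftedChoose_eq_div (y : ℝ) (n : ℕ) :
    shiftedChoose y n = (ascPochhammer ℝ n).eval (y + 1) / n.factorial := by
  have h := Ring.descPochhammer_eq_factorial_smul_choose (y + n) n
  rw [Polynomial.descPochhammer_smeval_eq_ascPochhammer, Polynomial.ascPochhammer_smeval_eq_eval,
    add_sub_cancel_right, nsmul_eq_mul] at h
  rw [h, mul_div_cancel_left₀ _ (by exact_mod_cast n.factorial_ne_zero), shiftedChoose]

theorem succ_mul_shiftedChoose (y : ℝ) (n : ℕ) :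
    ((n : ℝ) + 1) * shiftedChoose y (n + 1) = (y + n + 1) * shiftedChoose y n := by
  rw [shiftedChoose_eq_div, shiftedChoose_eq_div, ascPochhammer_succ_eval, Nat.factorial_succ]
  have : ((n.factorial : ℕ) : ℝ) ≠ 0 := by exact_mod_cast n.factorial_ne_zero
  push_cast
  field_simp
  ring

theorem shiftedChoose_pos {y : ℝ} (hy : 0 ≤ y) (n : ℕ) : 0 < shiftedChoose y n := by
  induction n with
  | zero => simp [shiftedChoose_zero]
  | succ n ih =>
    have h := succ_mul_shiftedChoose y n
    have : 0 < ((n : ℝ) + 1) * shiftedChoose y (n + 1) := by rw [h]; positivity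
    exact pos_of_mul_pos_right this (by positivity)

theorem shiftedChoose_monotone {y : ℝ} (hy : 0 ≤ y) : Monotone (shiftedChoose y) := by
  refine monotone_nat_of_le_succ fun n => ?_
  have h := succ_mul_shiftedChoose y n
  have hp := shiftedChoose_pos hy n
  refine le_of_mul_le_mul_left ?_ (show (0 : ℝ) < n + 1 by positivity)
  rw [h]
  nlinarith

/-- With `y + 1` in place of the factor `y` this is an equality, the hockey-stick identity. -/
theorem mul_sum_range_shiftedChoose_le {y : ℝ} (hy : 0 ≤ y) (n : ℕ) :
    y * ∑ i ∈ range n, shiftedChoose y i ≤ n * shiftedChoose y n := by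
  induction n with
  | zero => simp
  | succ n ih =>
    have h := succ_mul_shiftedChoose y n
    have hp := shiftedChoose_pos hy n
    rw [sum_range_succ]
    push_cast
    rw [h]
    nlinarith

/-- Among any `p` consecutive terms of a monotone sequence the first one is at most the average. -/
theorem Monotone.mul_sum_range_dvd_le {f : ℕ → ℝ} (hf : Monotone f) (h0 : ∀ i, 0 ≤ f i) {p : ℕ}
    (hp : 0 < p) (n : ℕ) :
    p * ∑ i ∈ range n, (if p ∣ n - i then f i else 0) ≤ ∑ i ∈ range n, f i := by
  induction n using Nat.strong_induction_on with
  | _ n ih =>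
    obtain hn | hn := lt_or_ge n p
    · rw [sum_eq_zero, mul_zero]
      · exact sum_nonneg fun i _ => h0 i
      · intro i hi
        rw [mem_range] at hi
        rw [if_neg]
        intro h
        have := Nat.le_of_dvd (by omega) h
        omega
    -- Split off the last block of `p` indices: only its first one, `k`, meets the divisibility
    -- condition, and `f k` is the least value there.
    · obtain ⟨k, rfl⟩ := Nat.exists_eq_add_of_le' hn
      have h1 : ∑ i ∈ range k, (if p ∣ k + p - i then f i else 0) =
          ∑ i ∈ range k, (if p ∣ k - i then f i else 0) := by
        refine sum_congr rfl fun i hi => ?_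
        rw [mem_range] at hi
        simp only [show k + p - i = (k - i) + p by omega, Nat.dvd_add_self_right]
      have h2 : ∑ x ∈ range p, (if p ∣ k + p - (k + x) then f (k + x) else 0) = f k := by
        rw [sum_eq_single_of_mem 0 (by simpa using hp)]
        · simp
        · intro x hx hx0
          rw [mem_range] at hx
          rw [if_neg]
          intro h
          have := Nat.le_of_dvd (by omega) h
          omega
      have h3 : p * f k ≤ ∑ x ∈ range p, f (k + x) := by
        have := card_nsmul_le_sum (range p) (fun x => f (k + x)) (f k)
          fun x _ => hf (Nat.le_add_right k x)
        simpa using this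
      rw [sum_range_add, sum_range_add, h1, h2, mul_add]
      linarith [ih k (by omega)]

/-- The inductive step for the weights in Newton's identities: by monotonicity, `v` at every `p`-th
index costs no more than `v / p` at every index. -/
theorem sum_range_shiftedChoose_mul_le {u v y : ℝ} (hu : 0 ≤ u) (hv : 0 ≤ v) {p : ℕ} (hp : 0 < p)
    (hy : y = u + v / p) (n : ℕ) :
    ∑ i ∈ range n, shiftedChoose y i * (u + if p ∣ n - i then v else 0) ≤
      n * shiftedChoose y n := by
  have hy0 : 0 ≤ y := by rw [hy]; positivity
  have hp' : (0 : ℝ) < p := by exact_mod_cast hp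
  refine le_trans ?_ (mul_sum_range_shiftedChoose_le hy0 n)
  have h := (shiftedChoose_monotone hy0).mul_sum_range_dvd_le
    (fun i => (shiftedChoose_pos hy0 i).le) hp n
  have h1 : ∑ i ∈ range n, shiftedChoose y i * (u + if p ∣ n - i then v else 0) =
      u * ∑ i ∈ range n, shiftedChoose y i +
        v / p * (p * ∑ i ∈ range n, if p ∣ n - i then shiftedChoose y i else 0) := by
    rw [← mul_assoc, div_mul_cancel₀ _ hp'.ne', mul_sum, mul_sum, ← sum_add_distrib]
    refine sum_congr rfl fun i _ => ?_
    split_ifs <;> ring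
  rw [h1]
  calc _ ≤ u * ∑ i ∈ range n, shiftedChoose y i + v / p * ∑ i ∈ range n, shiftedChoose y i := by
        gcongr
    _ = y * ∑ i ∈ range n, shiftedChoose y i := by rw [← add_mul, ← hy]

/-! ### Combinations of multiplicative characters, Gauss sums and Gauss periods -/

section

open scoped Classical

variable {F : Type*} [Field F]

theorem AddChar.IsPrimitive.mulShift {ψ : AddChar F ℂ} (hψ : ψ.IsPrimitive) {a : F} (ha : a ≠ 0) :
    (ψ.mulShift a).IsPrimitive := by
  intro b hb
  rw [AddChar.mulShift_mulShift]
  exact hψ (mul_ne_zero ha hb)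

/-- `HasCharSum f A` means that `f` is a linear combination of multiplicative characters whose
coefficients have absolute values that add up to at most `A`. -/
inductive HasCharSum : (Fˣ → ℂ) → ℝ → Prop
  | single (w : ℂ) (χ : MulChar F ℂ) : HasCharSum (fun c => w * χ c) ‖w‖
  | add {f g : Fˣ → ℂ} {A B : ℝ} :
      HasCharSum f A → HasCharSum g B → HasCharSum (f + g) (A + B)
  | mono {f : Fˣ → ℂ} {A B : ℝ} : HasCharSum f A → A ≤ B → HasCharSum f B

namespace HasCharSum

theorem const (w : ℂ) : HasCharSum (fun _ : Fˣ => w) ‖w‖ := by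
  simpa using single (F := F) w 1

theorem zero : HasCharSum (0 : Fˣ → ℂ) 0 := by
  simpa using! const (F := F) 0

theorem nonneg {f : Fˣ → ℂ} {A : ℝ} (hf : HasCharSum f A) : 0 ≤ A := by
  induction hf with
  | single w χ => positivity
  | add _ _ h1 h2 => positivity
  | mono _ h ih => exact ih.trans h

theorem mul {f g : Fˣ → ℂ} {A B : ℝ} (hf : HasCharSum f A) (hg : HasCharSum g B) :
    HasCharSum (f * g) (A * B) := by
  induction hf with
  | single w χ =>
    induction hg with
    | single z η =>
      convert single (w * z) (χ * η) using 1
      · ext c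
        simp only [Pi.mul_apply, MulChar.mul_apply]
        ring
      · simp
    | add _ _ h1 h2 =>
      rw [mul_add, mul_add]
      exact h1.add h2
    | mono _ h ih => exact ih.mono (by gcongr)
  | add _ _ h1 h2 =>
    rw [add_mul, add_mul]
    exact h1.add h2
  | mono _ h ih =>
    have := hg.nonneg
    exact ih.mono (by gcongr)

theorem const_mul {f : Fˣ → ℂ} {A : ℝ} (hf : HasCharSum f A) (w : ℂ) :
    HasCharSum (fun c => w * f c) (‖w‖ * A) :=
  (const w).mul hf

theorem sum {ι : Type*} (s : Finset ι) {f : ι → Fˣ → ℂ} {A : ι → ℝ}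
    (h : ∀ i ∈ s, HasCharSum (f i) (A i)) : HasCharSum (∑ i ∈ s, f i) (∑ i ∈ s, A i) := by
  induction s using Finset.induction_on with
  | empty => simpa using zero
  | insert i s hi ih =>
    rw [sum_insert hi, sum_insert hi]
    exact (h i (mem_insert_self i s)).add (ih fun j hj => h j (mem_insert_of_mem hj))

end HasCharSum

variable [Fintype F]

theorem norm_gaussSum_le (χ : MulChar F ℂ) {ψ : AddChar F ℂ} (hψ : ψ.IsPrimitive) :
    ‖gaussSum χ ψ‖ ≤ √(Fintype.card F : ℝ) := by
  by_cases hχ : χ = 1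
  · subst hχ
    have h1 : ψ ≠ 1 := by
      intro h
      refine hψ one_ne_zero ?_
      simp [h]
    rw [gaussSum_one_left h1, norm_neg, norm_one, Real.one_le_sqrt]
    exact_mod_cast Fintype.card_pos
  · refine Real.le_sqrt_of_sq_le ?_
    have h := gaussSum_mul_gaussSum_eq_card hχ hψ
    rw [← star_gaussSum_eq] at h
    have h2 := congrArg norm h
    rw [norm_mul, norm_star, Complex.norm_natCast] at h2
    rw [sq, h2]

theorem Fintype.sum_eq_zero_add_sum_units {M : Type*} [AddCommMonoid M] (f : F → M) :
    ∑ x, f x = f 0 + ∑ u : Fˣ, f u := by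
  rw [Fintype.sum_eq_add_sum_compl (0 : F)]
  congr 1
  symm
  refine sum_bij (fun u _ => (u : F)) (by simp) (fun u _ v _ h => Units.ext h) ?_ (by simp)
  intro x hx
  have hx' : x ≠ 0 := by simpa using hx
  exact ⟨Units.mk0 x hx', mem_univ _, rfl⟩

theorem gaussSum_eq_sum_units (χ : MulChar F ℂ) (ψ : AddChar F ℂ) :
    gaussSum χ ψ = ∑ u : Fˣ, χ u * ψ u := by
  rw [gaussSum, Fintype.sum_eq_zero_add_sum_units, MulChar.map_zero, zero_mul, zero_add]

/-- The character of `G` induced by a character of `G ⧸ H`. -/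
noncomputable def quotientHom {G : Type*} [CommGroup G] (H : Subgroup G)
    (θ : AddChar (Additive (G ⧸ H)) ℂ) : G →* ℂ where
  toFun u := θ (Additive.ofMul (u : G ⧸ H))
  map_one' := by simp
  map_mul' a b := by simp [AddChar.map_add_eq_mul]

/-- The dual group of `G ⧸ H`. -/
abbrev QuotientDual {G : Type*} [CommGroup G] (H : Subgroup G) : Type _ :=
  AddChar (Additive (G ⧸ H)) ℂ

noncomputable instance {G : Type*} [CommGroup G] [Finite G] (H : Subgroup G) :
    Fintype (QuotientDual H) :=
  AddChar.instFintype _ _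

theorem sum_quotientHom_apply {G : Type*} [CommGroup G] [Finite G] (H : Subgroup G) (u : G) :
    ∑ θ : QuotientDual H, quotientHom H θ u = if u ∈ H then (H.index : ℂ) else 0 := by
  have := Fintype.ofFinite (G ⧸ H)
  have h : (Additive.ofMul (u : G ⧸ H) = 0) ↔ u ∈ H := by
    rw [ofMul_eq_zero, QuotientGroup.eq_one_iff]
  change ∑ θ : AddChar (Additive (G ⧸ H)) ℂ, θ (Additive.ofMul (u : G ⧸ H)) = _
  rw [AddChar.sum_apply_eq_ite]
  simp only [h]
  congr 1
  rw [Subgroup.index, ← Nat.card_congr Additive.toMul, Nat.card_eq_fintype_card]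

theorem card_quotientDual {G : Type*} [CommGroup G] [Finite G] (H : Subgroup G) :
    Fintype.card (QuotientDual H) = H.index := by
  have := Fintype.ofFinite (G ⧸ H)
  rw [AddChar.card_eq, Subgroup.index, ← Nat.card_congr Additive.toMul, Nat.card_eq_fintype_card]

/-- The multiplicative character of `F` induced by a character of `Fˣ ⧸ H`. -/
noncomputable def quotientMulChar (H : Subgroup Fˣ) (θ : QuotientDual H) : MulChar F ℂ :=
  MulChar.ofUnitHom (quotientHom H θ).toHomUnits

theorem sum_quotientMulChar_apply (H : Subgroup Fˣ) (u : Fˣ) :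
    ∑ θ, quotientMulChar H θ u = if u ∈ H then (H.index : ℂ) else 0 := by
  rw [← sum_quotientHom_apply]
  simp [quotientMulChar]

/-- The expansion of a Gauss period in Gauss sums. -/
theorem index_mul_sum_addChar_subgroup (H : Subgroup Fˣ)
    (ψ : AddChar F ℂ) (c : Fˣ) :
    (H.index : ℂ) * ∑ h : H, ψ (c * (h : Fˣ)) =
      ∑ θ, gaussSum (quotientMulChar H θ) ψ * (quotientMulChar H θ)⁻¹ c := by
  have h1 : ∀ θ, gaussSum (quotientMulChar H θ) ψ * (quotientMulChar H θ)⁻¹ c =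
      ∑ u : Fˣ, quotientMulChar H θ u * ψ (c * u) := by
    intro θ
    -- Substituting `u ↦ c * u` in a Gauss sum pulls out the factor `χ⁻¹ c`.
    rw [mul_comm, ← gaussSum_mulShift_eq, gaussSum_eq_sum_units]
    rfl
  simp_rw [h1]
  rw [sum_comm]
  simp_rw [← sum_mul, sum_quotientMulChar_apply]
  simp_rw [ite_mul, zero_mul]
  rw [← sum_filter, mul_sum]
  refine (sum_subtype _ (by simp) (fun u : Fˣ => (H.index : ℂ) * ψ (c * u))).symm

namespace HasCharSum

theorem norm_apply_le {f : Fˣ → ℂ} {A : ℝ} (hf : HasCharSum f A) (c : Fˣ) : ‖f c‖ ≤ A := by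
  induction hf with
  | single w χ =>
    have h : ‖χ c‖ = 1 := by
      rw [← MulChar.coe_toUnitHom]
      refine Complex.norm_eq_one_of_pow_eq_one (n := Fintype.card Fˣ) ?_ Fintype.card_ne_zero
      rw [← Units.val_pow_eq_pow_val, ← map_pow, pow_card_eq_one, map_one, Units.val_one]
    rw [norm_mul, h, mul_one]
  | add _ _ h1 h2 => exact (norm_add_le _ _).trans (add_le_add h1 h2)
  | mono _ h ih => exact ih.trans h

theorem norm_sum_mul_addChar_le {f : Fˣ → ℂ} {A : ℝ} (hf : HasCharSum f A) {ψ : AddChar F ℂ}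
    (hψ : ψ.IsPrimitive) : ‖∑ c, f c * ψ c‖ ≤ A * √(Fintype.card F : ℝ) := by
  induction hf with
  | single w χ =>
    simp_rw [mul_assoc]
    rw [← mul_sum, ← gaussSum_eq_sum_units, norm_mul]
    gcongr
    exact norm_gaussSum_le χ hψ
  | add _ _ h1 h2 =>
    simp_rw [Pi.add_apply, add_mul, sum_add_distrib]
    exact (norm_add_le _ _).trans (add_le_add h1 h2)
  | mono _ h ih => exact ih.trans (by gcongr)

end HasCharSum

/-- The period is an average over the `m` characters trivial on `H`, each weighted by a Gauss sum.
-/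
theorem hasCharSum_sum_addChar_subgroup (H : Subgroup Fˣ)
    {ψ : AddChar F ℂ} (hψ : ψ.IsPrimitive) :
    HasCharSum (fun c : Fˣ => ∑ h : H, ψ (c * (h : Fˣ))) √(Fintype.card F : ℝ) := by
  have hm : H.index ≠ 0 := Subgroup.index_ne_zero_of_finite
  have h := (HasCharSum.sum univ fun (θ : QuotientDual H) _ =>
    (HasCharSum.single (gaussSum (quotientMulChar H θ) ψ) (quotientMulChar H θ)⁻¹).mono
      (norm_gaussSum_le _ hψ)).const_mul (H.index : ℂ)⁻¹
  have hm' : (H.index : ℂ) ≠ 0 := by exact_mod_cast hm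
  have hm'' : (H.index : ℝ) ≠ 0 := by exact_mod_cast hm
  convert h using 1
  · ext c
    rw [Finset.sum_apply, ← index_mul_sum_addChar_subgroup, inv_mul_cancel_left₀ hm']
  · rw [sum_const, card_univ, card_quotientDual, norm_inv, Complex.norm_natCast, nsmul_eq_mul,
      inv_mul_cancel_left₀ hm'']

end

/-! ### Newton's identities and the character sum counting subsets -/

section

open scoped Classical

/-- Newton's identities for the values of elementary symmetric polynomials. -/
theorem mul_sum_powersetCard_prod_eq {σ : Type*} [Fintype σ] (f : σ → ℂ) (k : ℕ) :
    (k : ℂ) * ∑ S ∈ powersetCard k univ, ∏ s ∈ S, f s =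
      (-1) ^ (k + 1) * ∑ i ∈ range k,
        (-1) ^ i * ((∑ S ∈ powersetCard i univ, ∏ s ∈ S, f s) * ∑ s, f s ^ (k - i)) := by
  have h := congrArg (MvPolynomial.aeval f) (MvPolynomial.mul_esymm_eq_sum σ ℂ k)
  have he : ∀ n, MvPolynomial.aeval f (MvPolynomial.esymm σ ℂ n) =
      ∑ S ∈ powersetCard n univ, ∏ s ∈ S, f s := by
    simp [MvPolynomial.esymm]
  have hp : ∀ n, MvPolynomial.aeval f (MvPolynomial.psum σ ℂ n) = ∑ s, f s ^ n := by
    simp [MvPolynomial.psum]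
  rw [sum_filter, Nat.sum_antidiagonal_eq_sum_range_succ_mk, sum_range_succ] at h
  simp only [lt_irrefl, if_false, add_zero, map_mul, map_sum, map_natCast, he, map_pow, map_neg,
    map_one] at h
  rw [h]
  congr 1
  refine sum_congr rfl fun i hi => ?_
  rw [if_pos (mem_range.1 hi)]
  simp only [map_mul, map_pow, map_neg, map_one, he, hp, mul_assoc]

variable {F : Type*} [Field F] [Fintype F]

theorem hasCharSum_sum_addChar_pow (p : ℕ) [CharP F p] (H : Subgroup Fˣ) {ψ : AddChar F ℂ}
    (hψ : ψ.IsPrimitive) {v : ℝ} (hv : (Nat.card H : ℝ) ≤ v) (l : ℕ) :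
    HasCharSum (fun c : Fˣ => ∑ h : H, ψ (c * (h : Fˣ)) ^ l)
      (√(Fintype.card F : ℝ) + if p ∣ l then v else 0) := by
  have h1 : ∀ x : F, ψ x ^ l = ψ (l * x) := fun x => by
    rw [← AddChar.map_nsmul_eq_pow, nsmul_eq_mul]
  simp_rw [h1]
  split_ifs with hl
  · rw [(CharP.cast_eq_zero_iff F p l).2 hl]
    simp only [zero_mul, AddChar.map_zero_eq_one]
    refine (HasCharSum.const _).mono ?_
    rw [sum_const, nsmul_one, Complex.norm_natCast, card_univ, ← Nat.card_eq_fintype_card]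
    exact hv.trans (le_add_of_nonneg_left (Real.sqrt_nonneg _))
  · rw [add_zero]
    have hl' : (l : F) ≠ 0 := fun h => hl ((CharP.cast_eq_zero_iff F p l).1 h)
    exact hasCharSum_sum_addChar_subgroup H (hψ.mulShift hl')

theorem AddChar.map_sum_eq_prod {A M ι : Type*} [AddCommMonoid A] [CommMonoid M] (ψ : AddChar A M)
    (f : ι → A) (s : Finset ι) : ψ (∑ i ∈ s, f i) = ∏ i ∈ s, ψ (f i) := by
  induction s using Finset.induction_on with
  | empty => simp
  | insert i s hi ih => rw [sum_insert hi, prod_insert hi, AddChar.map_add_eq_mul, ih]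

/-- The `k`-th elementary symmetric polynomial in the values `ψ (c * h)` for `h ∈ H`. -/
noncomputable def subsetCharSum (H : Subgroup Fˣ) (ψ : AddChar F ℂ) (k : ℕ) (c : F) : ℂ :=
  ∑ S ∈ powersetCard k (univ : Finset H), ψ (c * ∑ h ∈ S, ((h : Fˣ) : F))

theorem subsetCharSum_eq (H : Subgroup Fˣ) (ψ : AddChar F ℂ) (k : ℕ) (c : F) :
    subsetCharSum H ψ k c = ∑ S ∈ powersetCard k (univ : Finset H), ∏ h ∈ S, ψ (c * (h : Fˣ)) := by
  simp_rw [subsetCharSum, mul_sum, AddChar.map_sum_eq_prod ψ]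

theorem hasCharSum_subsetCharSum {p : ℕ} [CharP F p] (H : Subgroup Fˣ) {ψ : AddChar F ℂ}
    (hψ : ψ.IsPrimitive) {v : ℝ} (hv : (Nat.card H : ℝ) ≤ v) (k : ℕ) :
    HasCharSum (fun c : Fˣ => subsetCharSum H ψ k c)
      (shiftedChoose (√(Fintype.card F : ℝ) + v / p) k) := by
  induction k using Nat.strong_induction_on with
  | _ k ih =>
    obtain rfl | hk := Nat.eq_zero_or_pos k
    · simp only [subsetCharSum_eq, shiftedChoose_zero]
      simpa using HasCharSum.const (F := F) 1
    · have hp : 0 < p := Nat.pos_of_ne_zero (CharP.char_ne_zero_of_finite F p)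
      have hv0 : 0 ≤ v := (Nat.cast_nonneg _).trans hv
      have h := HasCharSum.sum (range k) fun i hi => ((ih i (mem_range.1 hi)).mul
        (hasCharSum_sum_addChar_pow p H hψ hv (k - i))).const_mul ((-1) ^ i)
      have h' := h.const_mul ((k : ℂ)⁻¹ * (-1) ^ (k + 1))
      have hk' : (k : ℂ) ≠ 0 := by exact_mod_cast hk.ne'
      have hk'' : (0 : ℝ) < k := by exact_mod_cast hk
      refine HasCharSum.mono ?_ (A := ‖(k : ℂ)⁻¹ * (-1) ^ (k + 1)‖ * ∑ i ∈ range k, ‖(-1 : ℂ) ^ i‖ *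
        (shiftedChoose (√(Fintype.card F : ℝ) + v / p) i *
          (√(Fintype.card F : ℝ) + if p ∣ k - i then v else 0))) ?_
      · convert h' using 1
        ext c
        rw [← inv_mul_cancel_left₀ hk' (subsetCharSum H ψ k c), subsetCharSum_eq,
          mul_sum_powersetCard_prod_eq]
        simp only [Finset.sum_apply, Pi.mul_apply, subsetCharSum_eq, mul_assoc]
      · have := sum_range_shiftedChoose_mul_le (Real.sqrt_nonneg (Fintype.card F : ℝ)) hv0 hp rfl k
        simp only [norm_mul, norm_inv, norm_pow, norm_neg, norm_one, one_pow, one_mul, mul_one,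
          Complex.norm_natCast]
        rwa [inv_mul_le_iff₀ hk'']

theorem subsetSumCount_eq_card_filter (H : Subgroup Fˣ) (k : ℕ) (b : F) :
    subsetSumCount ((fun u : Fˣ => (u : F)) '' (H : Set Fˣ)) k b =
      #((powersetCard k (univ : Finset H)).filter fun S : Finset H => ∑ h ∈ S, ((h : Fˣ) : F) = b) := by
  let e : H ↪ F := ⟨fun h => ((h : Fˣ) : F), fun a b h => Subtype.ext (Units.ext h)⟩
  rw [subsetSumCount, ← Set.ncard_coe_finset,
    ← Set.ncard_image_of_injective _ (Finset.map_injective e)]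
  congr 1
  ext S
  simp only [Set.mem_ofPred_eq, Set.mem_image, coe_filter, mem_powersetCard, subset_univ, true_and]
  constructor
  · rintro ⟨h1, h2, h3⟩
    have h4 : (S : Set F) ⊆ e '' ((univ : Finset H) : Set H) := by
      intro x hx
      obtain ⟨u, hu, rfl⟩ := h1 hx
      exact ⟨⟨u, hu⟩, by simp, rfl⟩
    obtain ⟨T, -, rfl⟩ := Finset.subset_set_image_iff.1 h4
    rw [← Finset.map_eq_image] at h2 h3 ⊢
    rw [card_map] at h2
    rw [sum_map] at h3
    exact ⟨T, ⟨h2, h3⟩, rfl⟩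
  · rintro ⟨T, ⟨h2, h3⟩, rfl⟩
    refine ⟨?_, by rwa [card_map], by rwa [sum_map]⟩
    intro x hx
    obtain ⟨h, -, rfl⟩ := Finset.mem_map.1 hx
    exact ⟨h, h.2, rfl⟩

/-- Orthogonality of the additive characters `x ↦ ψ (c * x)`, with the term `c = 0` split off. -/
theorem card_mul_subsetSumCount (H : Subgroup Fˣ) {ψ : AddChar F ℂ} (hψ : ψ.IsPrimitive) (k : ℕ)
    (b : F) :
    (Fintype.card F : ℂ) * subsetSumCount ((fun u : Fˣ => (u : F)) '' (H : Set Fˣ)) k b =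
      (Nat.card H).choose k + ∑ c : Fˣ, subsetCharSum H ψ k c * ψ.mulShift (-b) c := by
  have h1 : ∑ c : F, subsetCharSum H ψ k c * ψ.mulShift (-b) c =
      (Nat.card H).choose k + ∑ c : Fˣ, subsetCharSum H ψ k c * ψ.mulShift (-b) c := by
    rw [Fintype.sum_eq_zero_add_sum_units]
    simp [subsetCharSum, Nat.card_eq_fintype_card]
  rw [← h1]
  simp_rw [subsetCharSum, sum_mul]
  rw [sum_comm, subsetSumCount_eq_card_filter, card_filter]
  push_cast
  rw [mul_sum]
  refine sum_congr rfl fun S _ => ?_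
  simp_rw [AddChar.mulShift_apply, ← AddChar.map_add_eq_mul, mul_comm (-b), ← mul_add]
  rw [AddChar.sum_mulShift _ hψ, ← sub_eq_add_neg]
  simp [sub_eq_zero]

end

/-! ### The two estimates -/

/-- The binomial coefficients with a real upper argument are the generalized ones,
`Ring.choose x k = x (x - 1) ⋯ (x - k + 1) / k!`. The natural-number division `(q - 1) / m` is
exact, since `q = |F| ≥ 2` and the index `m` of `H` divides `|Fˣ| = q - 1`. -/
theorem theorem1 {F : Type*} [Field F] [Fintype F] (p : ℕ) [CharP F p]
    (q : ℕ) (hq : Fintype.card F = q)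
    (H : Subgroup Fˣ) (m : ℕ) (hm : H.index = m)
    (k : ℕ) (hk1 : 1 ≤ k) (hk2 : k ≤ (q - 1) / m) :
    (∀ b : F, b ≠ 0 →
      |(subsetSumCount ((fun u : Fˣ => (u : F)) '' (H : Set Fˣ)) k b : ℝ)
          - 1 / (q : ℝ) * (((q - 1) / m).choose k : ℝ)|
        ≤ 2 / √(q : ℝ) * Ring.choose (√(q : ℝ) + (k : ℝ) + (q : ℝ) / ((m : ℝ) * (p : ℝ))) k) ∧
    |(subsetSumCount ((fun u : Fˣ => (u : F)) '' (H : Set Fˣ)) k 0 : ℝ)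
        - 1 / (q : ℝ) * (((q - 1) / m).choose k : ℝ)|
      ≤ Ring.choose (√(q : ℝ) + (k : ℝ) + (q : ℝ) / ((m : ℝ) * (p : ℝ))) k := by
  classical
  subst hq hm
  set q := Fintype.card F with hq
  have hm0 : 0 < H.index := Nat.pos_of_ne_zero Subgroup.index_ne_zero_of_finite
  have hq0 : (0 : ℝ) < q := by exact_mod_cast Fintype.card_pos
  have hunits : Nat.card Fˣ = q - 1 := by
    rw [Nat.card_eq_fintype_card, Fintype.card_units]
  have hn : (q - 1) / H.index = Nat.card H := by
    rw [← hunits, ← H.card_mul_index, Nat.mul_div_cancel _ hm0]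
  rw [hn]
  have hv : (Nat.card H : ℝ) ≤ q / H.index := by
    rw [← hn]
    refine Nat.cast_div_le.trans ?_
    gcongr
    exact Nat.sub_le _ _
  have hψ := AddChar.FiniteField.primitiveChar_to_Complex_isPrimitive F
  set ψ := AddChar.FiniteField.primitiveChar_to_Complex F
  have hE := hasCharSum_subsetCharSum (p := p) H hψ hv k
  have hC : shiftedChoose (√(q : ℝ) + (q : ℝ) / H.index / p) k =
      Ring.choose (√(q : ℝ) + (k : ℝ) + (q : ℝ) / ((H.index : ℝ) * (p : ℝ))) k := by
    rw [shiftedChoose, div_div, add_right_comm]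
  rw [hC] at hE
  set C := Ring.choose (√(q : ℝ) + (k : ℝ) + (q : ℝ) / ((H.index : ℝ) * (p : ℝ))) k
  have hC0 : 0 ≤ C := hE.nonneg
  have key : ∀ b : F, |(subsetSumCount ((fun u : Fˣ => (u : F)) '' (H : Set Fˣ)) k b : ℝ)
      - 1 / (q : ℝ) * ((Nat.card H).choose k : ℝ)| =
      ‖∑ c : Fˣ, subsetCharSum H ψ k c * ψ.mulShift (-b) c‖ / q := by
    intro b
    have h := card_mul_subsetSumCount H hψ k b
    rw [← sub_eq_iff_eq_add'] at h
    rw [← h, eq_div_iff hq0.ne', ← abs_of_pos hq0, ← abs_mul, ← Real.norm_eq_abs,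
      ← Complex.norm_real, abs_of_pos hq0]
    congr 1
    push_cast
    have : (q : ℂ) ≠ 0 := by exact_mod_cast hq0.ne'
    rw [← hq]
    field_simp
  refine ⟨fun b hb => ?_, ?_⟩
  · rw [key, div_le_iff₀ hq0]
    refine (hE.norm_sum_mul_addChar_le (hψ.mulShift (neg_ne_zero.2 hb))).trans ?_
    -- The Gauss sum bound yields `C / √q`, so the factor `2` is slack.
    have h2 : 2 / √(q : ℝ) * C * q = 2 * (C * √(q : ℝ)) := by
      nth_rewrite 2 [← Real.mul_self_sqrt hq0.le]
      have : √(q : ℝ) ≠ 0 := (Real.sqrt_pos.2 hq0).ne'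
      field_simp
    rw [h2]
    have : 0 ≤ C * √(q : ℝ) := by positivity
    linarith
  · rw [key, div_le_iff₀ hq0]
    -- For `b = 0` there is no cancellation over `c`: each of the `q - 1` terms is at most `C`.
    refine (norm_sum_le_of_le univ (f := _) (n := fun _ => C) fun c _ => ?_).trans ?_
    · simpa using hE.norm_apply_le c
    · rw [sum_const, card_univ, nsmul_eq_mul, mul_comm]
      gcongr
      rw [Fintype.card_units]
      exact Nat.sub_le _ _
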